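/- Let $\mathcal K$ be an essentially small rigid tensor-triangulated category: a triangulated category with a symmetric monoidal structure $\otimes$ which is exact in each variable, in which every object is dualizable. Let $\mathrm{Spc}(\mathcal K)$ be its Balmer spectrum, i.e. the set of prime $\otimes$-ideals $\mathcal P\subset\mathcal K$ (proper thick $\otimes$-ideals such that $x\otimes y\in\mathcal P$ implies $x\in\mathcal P$ or $y\in\mathcal P$), with the topology having the sets $\mathrm{supp}(x)=\{\mathcal P\mid x\notin\mathcal P\}$, $x\in\mathcal K$, as a basis of closed sets. Let $h\colon\mathcal K\to\mathrm{mod}\text{-}\mathcal K$ be the Yoneda embedding $x\mapsto\mathrm{Hom}_{\mathcal K}(-,x)$ into the abelian category of finitely presented additive functors $\mathcal K^{\mathrm{op}}\to\mathrm{Ab}$, equipped with the tensor product which is right exact in each variable and satisfies $h(x)\otimes h(y)=h(x\otimes y)$. Let $\mathrm{Spc}^h(\mathcal K)$ be the homological spectrum, i.e. the set of maximal (proper) Serre $\otimes$-ideals $\mathcal B\subset\mathrm{mod}\text{-}\mathcal K$, with the topology having the sets $\mathrm{supp}^h(x)=\{\mathcal B\mid h(x)\notin\mathcal B\}$, $x\in\mathcal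 K$, as a basis of closed sets. Then $\mathcal B\mapsto h^{-1}(\mathcal B)$ is a well-defined map $\phi\colon\mathrm{Spc}^h(\mathcal K)\to\mathrm{Spc}(\mathcal K)$, and it exhibits $\mathrm{Spc}(\mathcal K)$ as the Kolmogorov ($T_0$) quotient of $\mathrm{Spc}^h(\mathcal K)$, i.e. it is, up to a homeomorphism, the quotient map of $\mathrm{Spc}^h(\mathcal K)$ by the relation of topological indistinguishability. In particular, for all $\mathcal B_1,\mathcal B_2\in\mathrm{Spc}^h(\mathcal K)$, $$\phi(\mathcal B_1)=\phi(\mathcal B_2)\iff\overline{\{\mathcal B_1\}}=\overline{\{\mathcal B_2\}}.$$ Moreover, the following are equivalent: (a) $\phi$ is a bijection; (b) $\phi$ is a homeomorphism; (c) $\mathrm{Spc}^h(\mathcal K)$ is a spectral space; (d) $\mathrm{Spc}^h(\mathcal K)$ is a $T_0$-space. -/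

import Mathlib

open CategoryTheory CategoryTheory.Limits CategoryTheory.Pretriangulated MonoidalCategory

universe w v u

namespace TTGeometry

section Balmer

variable (K : Type u) [Category.{v} K] [HasZeroObject K] [HasShift K ℤ] [Preadditive K]
  [∀ n : ℤ, (shiftFunctor K n).Additive] [Pretriangulated K] [MonoidalCategory K]

/-- A prime `⊗`-ideal of a tensor-triangulated category `K`: a thick subcategory (a triangulated
subcategory closed under direct summands) which is a `⊗`-ideal, which is proper, and which
contains one of `x`, `y` as soon as it contains `x ⊗ y`. -/
@[ext]
structure BalmerSpectrum where
  /-- the objects of the prime -/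
  obj : ObjectProperty K
  isTriangulated : obj.IsTriangulated
  isStableUnderRetracts : obj.IsStableUnderRetracts
  tensor_mem : ∀ x y : K, obj y → obj (x ⊗ y)
  unit_notMem : ¬ obj (𝟙_ K)
  mem_or_mem : ∀ x y : K, obj (x ⊗ y) → obj x ∨ obj y

variable {K}

/-- The universal support `supp(x) = {P | x ∉ P}` of an object `x`. -/
def supp (x : K) : Set (BalmerSpectrum K) := {P | ¬ P.obj x}

/-- The topology on the Balmer spectrum whose basic closed sets are the supports of objects. -/
instance : TopologicalSpace (BalmerSpectrum K) :=
  TopologicalSpace.generateFrom {U | ∃ x : K, U = (supp x)ᶜ}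

end Balmer

section Homological

variable {K : Type u} [Category.{v} K] [Preadditive K]

/-- A `K`-module `M : Kᵒᵖ ⥤ Ab` is presented by a morphism `f : x₁ ⟶ x₀` of `K` if there is an
exact sequence `h(x₁) ⟶ h(x₀) ⟶ M ⟶ 0` whose first map is `h(f)`, where `h` is the Yoneda
embedding `x ↦ Hom(-, x)`. -/
def IsPresentedBy {x₁ x₀ : K} (f : x₁ ⟶ x₀) (M : Kᵒᵖ ⥤ AddCommGrpCat.{v}) : Prop :=
  Nonempty (M ≅ cokernel (preadditiveYoneda.map f))

/-- The finitely presented `K`-modules: the cokernels of maps between representable functors.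
(Such functors are automatically additive, and as the categories `K` of interest have finite
direct sums, one representable on each side is enough.) -/
def IsFinitelyPresented : ObjectProperty (Kᵒᵖ ⥤ AddCommGrpCat.{v}) :=
  fun M => ∃ (x₁ x₀ : K) (f : x₁ ⟶ x₀), IsPresentedBy f M

variable [MonoidalCategory K] [HasBinaryBiproducts K]

/-- `L` is (isomorphic to) the tensor product `M ⊗ N` of the finitely presented modules `M`
and `N`. This is the Day convolution, i.e. the tensor product which is right exact in each
variable and satisfies `h(x) ⊗ h(y) = h(x ⊗ y)`: if `M` is the cokernel of `h(f)` for
`f : x₁ ⟶ x₀` and `N` is the cokernel of `h(g)` for `g : y₁ ⟶ y₀`, then `M ⊗ N` is the cokernel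
of `h((x₁ ⊗ y₀) ⊞ (x₀ ⊗ y₁)) ⟶ h(x₀ ⊗ y₀)` induced by `f ⊗ y₀` and `x₀ ⊗ g`. Up to isomorphism
it does not depend on the presentations. -/
def IsTensorProduct (M N L : Kᵒᵖ ⥤ AddCommGrpCat.{v}) : Prop :=
  ∃ (x₁ x₀ y₁ y₀ : K) (f : x₁ ⟶ x₀) (g : y₁ ⟶ y₀),
    IsPresentedBy f M ∧ IsPresentedBy g N ∧
      IsPresentedBy (biprod.desc (f ▷ y₀) (x₀ ◁ g)) L

/-- `B` is a Serre `⊗`-ideal of the abelian category of finitely presented `K`-modules. For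
triangulated `K` the finitely presented modules are closed under kernels and cokernels in the
functor category `Kᵒᵖ ⥤ Ab`, so exactness of sequences of finitely presented modules is exactness
in the functor category. -/
structure IsSerreTensorIdeal (B : ObjectProperty (Kᵒᵖ ⥤ AddCommGrpCat.{v})) : Prop where
  le_finitelyPresented : B ≤ IsFinitelyPresented
  zero_mem : ∀ M : Kᵒᵖ ⥤ AddCommGrpCat.{v}, IsZero M → B M
  serre : ∀ S : ShortComplex (Kᵒᵖ ⥤ AddCommGrpCat.{v}), S.ShortExact →
    IsFinitelyPresented S.X₁ → IsFinitelyPresented S.X₂ → IsFinitelyPresented S.X₃ →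
    (B S.X₂ ↔ B S.X₁ ∧ B S.X₃)
  tensor_mem : ∀ M N L : Kᵒᵖ ⥤ AddCommGrpCat.{v}, IsTensorProduct M N L → B N → B L

variable (K) in
/-- The homological spectrum of `K`: the set of homological primes, that is, of maximal
(among the proper ones) Serre `⊗`-ideals of the category of finitely presented `K`-modules. -/
@[ext]
structure HomologicalSpectrum where
  /-- the finitely presented modules which belong to the homological prime -/
  obj : ObjectProperty (Kᵒᵖ ⥤ AddCommGrpCat.{v})
  isMaximal : Maximal
    (fun B : ObjectProperty (Kᵒᵖ ⥤ AddCommGrpCat.{v}) =>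
      IsSerreTensorIdeal B ∧ B ≠ IsFinitelyPresented) obj

/-- The homological support `{B | h(x) ∉ B}` of an object `x` of `K`. -/
def homologicalSupp (x : K) : Set (HomologicalSpectrum K) :=
  {B | ¬ B.obj (preadditiveYoneda.obj x)}

/-- The topology on the homological spectrum whose basic closed sets are the homological supports
of objects of `K`. -/
instance : TopologicalSpace (HomologicalSpectrum K) :=
  TopologicalSpace.generateFrom {U | ∃ x : K, U = (homologicalSupp x)ᶜ}

end Homological

/-- `f : X → Y` exhibits `Y` as the Kolmogorov quotient of `X`, the quotient space of `X` by the
relation of topological indistinguishability: `f` is, up to a homeomorphism, the quotient map. -/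
def IsKolmogorovQuotient {X Y : Type*} [TopologicalSpace X] [TopologicalSpace Y]
    (f : X → Y) : Prop :=
  ∃ e : SeparationQuotient X ≃ₜ Y, ∀ x : X, e (SeparationQuotient.mk x) = f x

end TTGeometry

/-! The map φ pulls the support of `x` back to its homological support, so it is inducing
(`isInducing_comap`). A surjective inducing map onto a T₀ space is a Kolmogorov quotient, and
`BalmerSpectrum K` is T₀, in fact spectral. What remains is that φ lands in primes and is
surjective.

Thickness of `h⁻¹(B)`: each vertex of a triangle is, after Yoneda, an extension of the kernels of
two consecutive maps. Primality: if `h(x) ∉ B`, the ideal of all `M` with `h(x) ⊗ M ∈ B` is proper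
and contains `B`, hence equals `B` by maximality. Here `h(x) ⊗ M` is `M(w ⊗ -)` for `w` a dual of
`x`, so it is visibly exact in `M`.

Surjectivity (`comap_surjective`): for a prime `P`, the modules that vanish in `K/P` after a twist
by some `w ∉ P` form a proper Serre ⊗-ideal `P.torsion`. It contains `h(P)`, and also the kernel of
`h` of the coevaluation `𝟙 ⟶ x ⊗ xᘁ` for every `x ∉ P`. Zorn places it inside some maximal `B`. If
`h(x) ∈ B` with `x ∉ P`, then `h(𝟙)` is an extension of a submodule of `h(x ⊗ xᘁ)` by that kernel,
so `h(𝟙) ∈ B`, a contradiction. -/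

namespace TTGeometry

open Opposite

/-! ### Presheaves of abelian groups and their presentations -/

section Modules

variable {K : Type u} [Category.{v} K]

/-- Exactness of complexes of presheaves of abelian groups is detected on sections. -/
lemma exact_iff_forall_app (S : ShortComplex (Kᵒᵖ ⥤ AddCommGrpCat.{v})) :
    S.Exact ↔ ∀ z : Kᵒᵖ, Function.Exact (S.f.app z) (S.g.app z) := by
  have key : S.Exact ↔ ∀ z : Kᵒᵖ, (S.map ((evaluation _ _).obj z)).Exact := by
    simp only [ShortComplex.exact_iff_isZero_homology, Functor.isZero_iff]
    exact forall_congr' fun z =>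
      (S.mapHomologyIso ((evaluation Kᵒᵖ AddCommGrpCat.{v}).obj z)).symm.isZero_iff
  rw [key]
  exact forall_congr' fun z => ShortComplex.ab_exact_iff_function_exact _

lemma epi_iff_forall_surjective {M N : Kᵒᵖ ⥤ AddCommGrpCat.{v}} (p : M ⟶ N) :
    Epi p ↔ ∀ z : Kᵒᵖ, Function.Surjective (p.app z) := by
  rw [NatTrans.epi_iff_epi_app]
  exact forall_congr' fun z => AddCommGrpCat.epi_iff_surjective _

lemma mono_iff_forall_injective {M N : Kᵒᵖ ⥤ AddCommGrpCat.{v}} (p : M ⟶ N) :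
    Mono p ↔ ∀ z : Kᵒᵖ, Function.Injective (p.app z) := by
  rw [NatTrans.mono_iff_mono_app]
  exact forall_congr' fun z => AddCommGrpCat.mono_iff_injective _

/-- Short exactness of complexes of presheaves of abelian groups is detected on sections. -/
lemma shortExact_iff_forall_app (S : ShortComplex (Kᵒᵖ ⥤ AddCommGrpCat.{v})) :
    S.ShortExact ↔ (∀ z : Kᵒᵖ, Function.Injective (S.f.app z)) ∧
      (∀ z : Kᵒᵖ, Function.Exact (S.f.app z) (S.g.app z)) ∧
      ∀ z : Kᵒᵖ, Function.Surjective (S.g.app z) := by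
  rw [← exact_iff_forall_app, ← epi_iff_forall_surjective, ← mono_iff_forall_injective]
  exact ⟨fun h => ⟨h.mono_f, h.exact, h.epi_g⟩, fun ⟨h₁, h₂, h₃⟩ => { exact := h₂ }⟩

lemma shortExact_of_iso {X M N : Kᵒᵖ ⥤ AddCommGrpCat.{v}} (hX : IsZero X) (e : M ≅ N) :
    (ShortComplex.mk (0 : X ⟶ M) e.hom zero_comp).ShortExact := by
  have : Mono (0 : X ⟶ M) := hX.mono _
  refine { exact := ?_ }
  rw [ShortComplex.exact_iff_mono _ rfl]
  infer_instance

variable [Preadditive K]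

/-- The morphism `h(x) ⟶ M` corresponding to a section `m ∈ M(x)`. -/
def ofSection (M : Kᵒᵖ ⥤ AddCommGrpCat.{v}) [M.Additive] {x : K} (m : M.obj (op x)) :
    preadditiveYoneda.obj x ⟶ M where
  app z := AddCommGrpCat.ofHom
    (AddMonoidHom.mk' (fun u : z.unop ⟶ x => M.map u.op m) fun a b => by
      have h : (show z.unop ⟶ x from a + b).op =
        (show z.unop ⟶ x from a).op + (show z.unop ⟶ x from b).op := rfl
      change M.map (show z.unop ⟶ x from a + b).op m = _
      rw [h, M.map_add]
      rfl)
  naturality z z' a := by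
    ext (u : z.unop ⟶ x)
    change M.map (a.unop ≫ u).op m = M.map a (M.map u.op m)
    simp

lemma yoneda_naturality {M : Kᵒᵖ ⥤ AddCommGrpCat.{v}} {x : K}
    (p : preadditiveYoneda.obj x ⟶ M) {z : K} (u : z ⟶ x) :
    M.map u.op (p.app (op x) (𝟙 x)) = p.app (op z) u := by
  have := ConcreteCategory.congr_hom (p.naturality u.op) (𝟙 x)
  refine this.symm.trans ?_
  change p.app (op z) (u ≫ 𝟙 x) = _
  rw [Category.comp_id]

lemma isPresentedBy_of_exact {x₁ x₀ : K} (f : x₁ ⟶ x₀) {M : Kᵒᵖ ⥤ AddCommGrpCat.{v}}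
    (p : preadditiveYoneda.obj x₀ ⟶ M) (hp : ∀ z : Kᵒᵖ, Function.Surjective (p.app z))
    (hex : ∀ z : Kᵒᵖ, Function.Exact ((preadditiveYoneda.map f).app z) (p.app z)) :
    IsPresentedBy f M := by
  have : Epi p := (epi_iff_forall_surjective _).2 hp
  have w : preadditiveYoneda.map f ≫ p = 0 := by
    ext z u
    exact (hex z).apply_apply_eq_zero u
  have hS := (exact_iff_forall_app (ShortComplex.mk _ _ w)).2 hex
  exact ⟨hS.gIsCokernel.coconePointUniqueUpToIso (colimit.isColimit _)⟩

/-- A presheaf is presented by `f : x₁ ⟶ x₀` if and only if it is additive and generated by a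
section over `x₀` whose annihilator consists of the morphisms that factor through `f`. -/
lemma isPresentedBy_iff {x₁ x₀ : K} (f : x₁ ⟶ x₀) (M : Kᵒᵖ ⥤ AddCommGrpCat.{v}) :
    IsPresentedBy f M ↔ M.Additive ∧ ∃ m : M.obj (op x₀),
      (∀ (z : K) (n : M.obj (op z)), ∃ u : z ⟶ x₀, M.map u.op m = n) ∧
      ∀ (z : K) (u : z ⟶ x₀), M.map u.op m = 0 ↔ ∃ v : z ⟶ x₁, v ≫ f = u := by
  constructor
  · rintro ⟨e⟩
    let p : preadditiveYoneda.obj x₀ ⟶ M := cokernel.π (preadditiveYoneda.map f) ≫ e.inv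
    have hp : ∀ z : Kᵒᵖ, Function.Surjective (p.app z) :=
      (epi_iff_forall_surjective p).1 inferInstance
    have hex : ∀ z : Kᵒᵖ, Function.Exact ((preadditiveYoneda.map f).app z) (p.app z) := by
      refine (exact_iff_forall_app (ShortComplex.mk (preadditiveYoneda.map f) p
        (by simp [p]))).1 ?_
      refine ShortComplex.exact_of_iso ?_
        (ShortComplex.exact_cokernel (preadditiveYoneda.map f))
      exact ShortComplex.isoMk (Iso.refl _) (Iso.refl _) e.symm
    refine ⟨⟨fun {X Y a b} => ?_⟩, p.app (op x₀) (𝟙 x₀), fun z n => ?_, fun z u => ?_⟩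
    · ext n
      obtain ⟨u, rfl⟩ := hp _ n
      have h := fun c : X ⟶ Y => ConcreteCategory.congr_hom (p.naturality c) u
      change M.map (a + b) (p.app X u) = M.map a (p.app X u) + M.map b (p.app X u)
      have h' := fun c : X ⟶ Y => (h c).symm
      simp only [ConcreteCategory.comp_apply] at h'
      rw [h', h', h', Functor.map_add, ← map_add]
      rfl
    · obtain ⟨u, rfl⟩ := hp _ n
      exact ⟨u, yoneda_naturality p u⟩
    · rw [yoneda_naturality]
      exact hex (op z) u
  · rintro ⟨_, m, h₁, h₂⟩
    exact isPresentedBy_of_exact f (ofSection M m) (fun z n => h₁ z.unop n)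
      fun z u => h₂ z.unop u

lemma isPresentedBy_zero (a x : K) : IsPresentedBy (0 : a ⟶ x) (preadditiveYoneda.obj x) := by
  refine (isPresentedBy_iff _ _).2 ⟨inferInstance, 𝟙 x, fun z n => ⟨n, ?_⟩, fun z u => ?_⟩
  · exact Category.comp_id (X := z) (Y := x) n
  · change u ≫ 𝟙 x = 0 ↔ _
    simp [eq_comm]

/-- Only the image of `h(f)` in `h(c)` matters, so `u` and `v` need not be mutually inverse. -/
lemma IsPresentedBy.change {a a' c c' : K} {f : a ⟶ c} {f' : a' ⟶ c'}
    {M : Kᵒᵖ ⥤ AddCommGrpCat.{v}} (h : IsPresentedBy f M) (e : c ≅ c')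
    (u : a ⟶ a') (hu : f ≫ e.hom = u ≫ f') (v : a' ⟶ a) (hv : f' ≫ e.inv = v ≫ f) :
    IsPresentedBy f' M := by
  obtain ⟨hM, m, h₁, h₂⟩ := (isPresentedBy_iff _ _).1 h
  refine (isPresentedBy_iff _ _).2 ⟨hM, M.map e.inv.op m, fun z n => ?_, fun z t => ?_⟩
  · obtain ⟨t, rfl⟩ := h₁ z n
    exact ⟨t ≫ e.hom, by simp [← ConcreteCategory.comp_apply, ← M.map_comp, ← op_comp]⟩
  · rw [← ConcreteCategory.comp_apply, ← M.map_comp, ← op_comp, h₂]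
    constructor
    · rintro ⟨s, hs⟩
      exact ⟨s ≫ u, by rw [Category.assoc, ← hu, reassoc_of% hs]; simp⟩
    · rintro ⟨s, rfl⟩
      exact ⟨s ≫ v, by simp [hv]⟩

/-- Precomposition with `F` is exact and sends `Hom(-, x)` to `Hom(F -, x) ≅ Hom(-, G x)`. -/
lemma IsPresentedBy.of_adjunction {x₁ x₀ : K} {f : x₁ ⟶ x₀} {M : Kᵒᵖ ⥤ AddCommGrpCat.{v}}
    (h : IsPresentedBy f M) {F G : K ⥤ K} [F.Additive] (adj : F ⊣ G) :
    IsPresentedBy (G.map f) (F.op ⋙ M) := by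
  obtain ⟨hM, m, h₁, h₂⟩ := (isPresentedBy_iff _ _).1 h
  have key : ∀ (z : K) (t : z ⟶ G.obj x₀), (F.op ⋙ M).map t.op (M.map (adj.counit.app x₀).op m) =
      M.map ((adj.homEquiv _ _).symm t).op m := fun z t => by
    rw [adj.homEquiv_counit, op_comp, M.map_comp]
    rfl
  refine (isPresentedBy_iff _ _).2 ⟨inferInstance, M.map (adj.counit.app x₀).op m,
    fun z n => ?_, fun z t => ?_⟩
  · obtain ⟨t, rfl⟩ := h₁ _ n
    exact ⟨adj.homEquiv _ _ t, by rw [key, Equiv.symm_apply_apply]⟩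
  · rw [key, h₂]
    constructor
    · rintro ⟨s, hs⟩
      exact ⟨adj.homEquiv _ _ s, by
        rw [← adj.homEquiv_naturality_right, hs, Equiv.apply_symm_apply]⟩
    · rintro ⟨s, rfl⟩
      exact ⟨(adj.homEquiv _ _).symm s, by rw [adj.homEquiv_naturality_right_symm]⟩

lemma IsPresentedBy.of_iso {x₁ x₀ : K} {f : x₁ ⟶ x₀} {M N : Kᵒᵖ ⥤ AddCommGrpCat.{v}}
    (h : IsPresentedBy f M) (e : M ≅ N) : IsPresentedBy f N :=
  h.map fun i => e.symm ≪≫ i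

lemma IsFinitelyPresented.of_iso {M N : Kᵒᵖ ⥤ AddCommGrpCat.{v}}
    (h : IsFinitelyPresented M) (e : M ≅ N) : IsFinitelyPresented N :=
  let ⟨_, _, f, hf⟩ := h
  ⟨_, _, f, hf.of_iso e⟩

lemma isFinitelyPresented_yoneda (x : K) : IsFinitelyPresented (preadditiveYoneda.obj x) :=
  ⟨x, x, 0, isPresentedBy_zero x x⟩

lemma IsPresentedBy.exists_epi {a a' c : K} {f : a ⟶ c} {f' : a' ⟶ c} {M M' : Kᵒᵖ ⥤ AddCommGrpCat.{v}}
    (h : IsPresentedBy f M) (h' : IsPresentedBy f' M') (u : a ⟶ a') (hu : u ≫ f' = f) :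
    ∃ p : M ⟶ M', Epi p := by
  obtain ⟨e⟩ := h
  obtain ⟨e'⟩ := h'
  let q : cokernel (preadditiveYoneda.map f) ⟶ cokernel (preadditiveYoneda.map f') :=
    cokernel.desc _ (cokernel.π _) (by rw [← hu, Functor.map_comp, Category.assoc,
      cokernel.condition, comp_zero])
  have : Epi q := epi_of_epi_fac (cokernel.π_desc _ _ _)
  exact ⟨e.hom ≫ q ≫ e'.inv, inferInstance⟩

end Modules

/-! ### Kernels of maps of presheaves, computed on sections -/

section Kernels

variable {K : Type u} [Category.{v} K]

lemma exact_of_comp_injective {X Y Z W : Type*} [Zero Z] [Zero W] {f : X → Y} {g : Y → Z}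
    {i : Z → W} {k : Y → W} (hi : Function.Injective i) (hi₀ : i 0 = 0)
    (hk : ∀ y, i (g y) = k y) (h : Function.Exact f k) : Function.Exact f g := fun y => by
  rw [← h y, ← hk, ← hi₀, hi.eq_iff]

lemma kernel_ι_exact {M N : Kᵒᵖ ⥤ AddCommGrpCat.{v}} (p : M ⟶ N) (z : Kᵒᵖ) :
    Function.Exact ((kernel.ι p).app z) (p.app z) :=
  (exact_iff_forall_app _).1 (ShortComplex.exact_kernel p) z

lemma kernel_ι_injective {M N : Kᵒᵖ ⥤ AddCommGrpCat.{v}} (p : M ⟶ N) (z : Kᵒᵖ) :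
    Function.Injective ((kernel.ι p).app z) :=
  (mono_iff_forall_injective _).1 inferInstance z

lemma kernel_lift_app {L M N : Kᵒᵖ ⥤ AddCommGrpCat.{v}} (q : L ⟶ M) (p : M ⟶ N) (w : q ≫ p = 0)
    (z : Kᵒᵖ) (n : L.obj z) :
    (kernel.ι p).app z ((kernel.lift p q w).app z n) = q.app z n := by
  rw [← ConcreteCategory.comp_apply, ← NatTrans.comp_app, kernel.lift_ι]

lemma kernel_lift_surjective {L M N : Kᵒᵖ ⥤ AddCommGrpCat.{v}} (q : L ⟶ M) (p : M ⟶ N)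
    (w : q ≫ p = 0) (h : ∀ z, Function.Exact (q.app z) (p.app z)) (z : Kᵒᵖ) :
    Function.Surjective ((kernel.lift p q w).app z) := fun n => by
  obtain ⟨m, hm⟩ := (h z _).1 ((kernel_ι_exact p z).apply_apply_eq_zero n)
  exact ⟨m, kernel_ι_injective p z ((kernel_lift_app ..).trans hm)⟩

end Kernels

/-! ### Distinguished triangles under the Yoneda embedding -/

section Triangles

variable {K : Type u} [Category.{v} K] [HasZeroObject K] [HasShift K ℤ] [Preadditive K]
  [∀ n : ℤ, (shiftFunctor K n).Additive] [Pretriangulated K]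

lemma exact_yoneda_of_distTriang {T : Triangle K} (hT : T ∈ distTriang K) (z : Kᵒᵖ) :
    Function.Exact ((preadditiveYoneda.map T.mor₁).app z)
      ((preadditiveYoneda.map T.mor₂).app z) := by
  intro (t : z.unop ⟶ T.obj₂)
  constructor
  · intro (ht : t ≫ T.mor₂ = 0)
    obtain ⟨s, hs⟩ := Triangle.coyoneda_exact₂ T hT t ht
    exact ⟨s, hs.symm⟩
  · rintro ⟨s, rfl⟩
    exact (Category.assoc (W := z.unop) s T.mor₁ T.mor₂).trans
      ((congrArg _ (comp_distTriang_mor_zero₁₂ _ hT)).trans comp_zero)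

lemma yoneda_comp_eq_zero {T : Triangle K} (hT : T ∈ distTriang K) :
    preadditiveYoneda.map T.mor₁ ≫ preadditiveYoneda.map T.mor₂ = 0 := by
  rw [← Functor.map_comp, comp_distTriang_mor_zero₁₂ _ hT, Functor.map_zero]

lemma yoneda_comp_eq_zero' {T : Triangle K} (hT : T ∈ distTriang K) :
    preadditiveYoneda.map T.mor₂ ≫ preadditiveYoneda.map T.mor₃ = 0 := by
  rw [← Functor.map_comp, comp_distTriang_mor_zero₂₃ _ hT, Functor.map_zero]

/-- The kernel of `h(x₂) ⟶ h(x₃)`, where `x₁ ⟶ x₂ ⟶ x₃ ⟶ x₁⟦1⟧` is a distinguished triangle,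
is finitely presented. -/
lemma isFinitelyPresented_kernel {T : Triangle K} (hT : T ∈ distTriang K) :
    IsFinitelyPresented (kernel (preadditiveYoneda.map T.mor₂)) := by
  refine ⟨_, _, T.invRotate.mor₁, isPresentedBy_of_exact _
    (kernel.lift _ (preadditiveYoneda.map T.mor₁) (yoneda_comp_eq_zero hT))
    (kernel_lift_surjective _ _ _ (exact_yoneda_of_distTriang hT)) fun z => ?_⟩
  exact exact_of_comp_injective (kernel_ι_injective _ z) (map_zero _)
    (kernel_lift_app _ _ (yoneda_comp_eq_zero hT) z)
    (exact_yoneda_of_distTriang (inv_rot_of_distTriang _ hT) z)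

/-- A distinguished triangle `x₁ ⟶ x₂ ⟶ x₃ ⟶ x₁⟦1⟧` presents `h(x₂)` as an extension of
the kernels of two consecutive maps. -/
lemma shortExact_kernel {T : Triangle K} (hT : T ∈ distTriang K) :
    (ShortComplex.mk (kernel.ι (preadditiveYoneda.map T.mor₂))
      (kernel.lift (preadditiveYoneda.map T.mor₃) (preadditiveYoneda.map T.mor₂)
        (yoneda_comp_eq_zero' hT))
      (by rw [← cancel_mono (kernel.ι _), Category.assoc, kernel.lift_ι _ _
        (yoneda_comp_eq_zero' hT), zero_comp, kernel.condition])).ShortExact := by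
  refine (shortExact_iff_forall_app _).2 ⟨kernel_ι_injective _, fun z => ?_,
    kernel_lift_surjective _ _ _ (exact_yoneda_of_distTriang (rot_of_distTriang _ hT))⟩
  exact exact_of_comp_injective (kernel_ι_injective (preadditiveYoneda.map T.mor₃) z) (map_zero _)
    (kernel_lift_app _ _ (yoneda_comp_eq_zero' hT) z)
    (kernel_ι_exact (preadditiveYoneda.map T.mor₂) z)

end Triangles

/-! ### Tensor products of modules and twists by dualizable objects -/

section Braided

variable {K : Type u} [Category.{v} K] [MonoidalCategory K] [BraidedCategory K]

/-- The permutation `x ⊗ (a ⊗ b) ≅ a ⊗ (x ⊗ b)`. -/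
def tensorLeftComm (x a b : K) : x ⊗ a ⊗ b ≅ a ⊗ x ⊗ b :=
  (α_ x a b).symm ≪≫ whiskerRightIso (β_ x a) b ≪≫ α_ a x b

lemma tensorLeftComm_naturality_left (x : K) {a a' : K} (f : a ⟶ a') (b : K) :
    x ◁ f ▷ b ≫ (tensorLeftComm x a' b).hom = (tensorLeftComm x a b).hom ≫ f ▷ (x ⊗ b) := by
  have := BraidedCategory.braiding_naturality_right x f
  simp only [tensorLeftComm, Iso.trans_hom, Iso.symm_hom, whiskerRightIso_hom, Category.assoc,
    associator_inv_naturality_middle_assoc, ← comp_whiskerRight_assoc, this]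
  simp

lemma tensorLeftComm_naturality_right (x a : K) {b b' : K} (g : b ⟶ b') :
    x ◁ a ◁ g ≫ (tensorLeftComm x a b').hom = (tensorLeftComm x a b).hom ≫ a ◁ x ◁ g := by
  simp only [tensorLeftComm, Iso.trans_hom, Iso.symm_hom, whiskerRightIso_hom, Category.assoc,
    associator_inv_naturality_right_assoc, whisker_exchange_assoc, associator_naturality_right]

end Braided

section Tensor

variable {K : Type u} [Category.{v} K] [MonoidalCategory K]

/-- The presheaf `M(w ⊗ -)`. If `w` is a dual of `x`, this is `h(x) ⊗ M`. -/
abbrev twist (w : K) (M : Kᵒᵖ ⥤ AddCommGrpCat.{v}) : Kᵒᵖ ⥤ AddCommGrpCat.{v} :=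
  (tensorLeft w).op ⋙ M

lemma twist_shortExact (w : K) {S : ShortComplex (Kᵒᵖ ⥤ AddCommGrpCat.{v})} (hS : S.ShortExact) :
    (S.map ((Functor.whiskeringLeft _ _ AddCommGrpCat.{v}).obj (tensorLeft w).op)).ShortExact := by
  obtain ⟨h₁, h₂, h₃⟩ := (shortExact_iff_forall_app _).1 hS
  exact (shortExact_iff_forall_app _).2 ⟨fun z => h₁ _, fun z => h₂ _, fun z => h₃ _⟩

section

variable [Preadditive K] [HasBinaryBiproducts K]

lemma IsTensorProduct.isFinitelyPresented {M N L : Kᵒᵖ ⥤ AddCommGrpCat.{v}}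
    (h : IsTensorProduct M N L) : IsFinitelyPresented L :=
  let ⟨_, _, _, _, _, _, _, _, hL⟩ := h
  ⟨_, _, _, hL⟩

lemma IsSerreTensorIdeal.of_iso {B : ObjectProperty (Kᵒᵖ ⥤ AddCommGrpCat.{v})}
    (hB : IsSerreTensorIdeal B) {M N : Kᵒᵖ ⥤ AddCommGrpCat.{v}} (e : M ≅ N)
    (h : B M) : B N := by
  have hz := isZero_zero (Kᵒᵖ ⥤ AddCommGrpCat.{v})
  have hM := hB.le_finitelyPresented _ h
  exact ((hB.serre _ (shortExact_of_iso hz e)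
    (hB.le_finitelyPresented _ (hB.zero_mem _ hz)) hM (hM.of_iso e)).1 h).2

end

variable [Preadditive K] [MonoidalPreadditive K]

lemma IsPresentedBy.twist {x₁ x₀ : K} {f : x₁ ⟶ x₀} {M : Kᵒᵖ ⥤ AddCommGrpCat.{v}}
    (h : IsPresentedBy f M) (x w : K) [ExactPairing x w] : IsPresentedBy (x ◁ f) (twist w M) :=
  h.of_adjunction (tensorLeftAdjunction x w)

lemma IsFinitelyPresented.twist {M : Kᵒᵖ ⥤ AddCommGrpCat.{v}} (h : IsFinitelyPresented M)
    (x w : K) [ExactPairing x w] : IsFinitelyPresented (twist w M) :=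
  let ⟨_, _, _, hf⟩ := h
  ⟨_, _, _, hf.twist x w⟩

variable [HasBinaryBiproducts K]

lemma isTensorProduct_yoneda (x y : K) : IsTensorProduct (preadditiveYoneda.obj x)
    (preadditiveYoneda.obj y) (preadditiveYoneda.obj (x ⊗ y)) := by
  refine ⟨x, x, y, y, 0, 0, isPresentedBy_zero _ _, isPresentedBy_zero _ _, ?_⟩
  have : biprod.desc ((0 : x ⟶ x) ▷ y) (x ◁ (0 : y ⟶ y)) = 0 := by
    ext <;> simp
  rw [this]
  exact isPresentedBy_zero _ _

lemma isTensorProduct_unit {M : Kᵒᵖ ⥤ AddCommGrpCat.{v}} (h : IsFinitelyPresented M) :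
    IsTensorProduct M (preadditiveYoneda.obj (𝟙_ K)) M := by
  obtain ⟨x₁, x₀, f, hf⟩ := h
  refine ⟨x₁, x₀, 𝟙_ K, 𝟙_ K, f, 0, hf, isPresentedBy_zero _ _, ?_⟩
  refine hf.change (ρ_ x₀).symm ((ρ_ x₁).inv ≫ biprod.inl) ?_
    (biprod.desc (ρ_ x₁).hom 0) ?_
  · simp
  · ext <;> simp

/-- This is `h(x) ⊗ (M ⊗ N) ≅ M ⊗ (h(x) ⊗ N)`, checked on generators and relations by moving `x`
past the first factor. -/
lemma IsTensorProduct.twist [BraidedCategory K] {M N L : Kᵒᵖ ⥤ AddCommGrpCat.{v}}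
    (h : IsTensorProduct M N L) (x w : K) [ExactPairing x w] :
    IsTensorProduct M (twist w N) (twist w L) := by
  obtain ⟨x₁, x₀, y₁, y₀, f, g, hM, hN, hL⟩ := h
  refine ⟨x₁, x₀, x ⊗ y₁, x ⊗ y₀, f, x ◁ g, hM, hN.twist x w, ?_⟩
  refine (hL.twist x w).change (tensorLeftComm x x₀ y₀)
    (x ◁ biprod.fst ≫ (tensorLeftComm x x₁ y₀).hom ≫ biprod.inl +
      x ◁ biprod.snd ≫ (tensorLeftComm x x₀ y₁).hom ≫ biprod.inr) ?_
    (biprod.desc ((tensorLeftComm x x₁ y₀).inv ≫ x ◁ biprod.inl)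
      ((tensorLeftComm x x₀ y₁).inv ≫ x ◁ biprod.inr)) ?_
  · rw [biprod.desc_eq, MonoidalPreadditive.whiskerLeft_add, Preadditive.add_comp,
      Preadditive.add_comp]
    simp only [MonoidalCategory.whiskerLeft_comp, Category.assoc, tensorLeftComm_naturality_left,
      tensorLeftComm_naturality_right, biprod.inl_desc, biprod.inr_desc]
  · ext
    · simp only [biprod.inl_desc_assoc, Category.assoc, ← MonoidalCategory.whiskerLeft_comp,
        biprod.inl_desc]
      rw [Iso.comp_inv_eq, Category.assoc, tensorLeftComm_naturality_left, Iso.inv_hom_id_assoc]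
    · simp only [biprod.inr_desc_assoc, Category.assoc, ← MonoidalCategory.whiskerLeft_comp,
        biprod.inr_desc]
      rw [Iso.comp_inv_eq, Category.assoc, tensorLeftComm_naturality_right, Iso.inv_hom_id_assoc]

/-- A generator `h(x₀) ⟶ M` induces an epimorphism `h(x₀) ⊗ N ⟶ M ⊗ N`; closure under ⊗ thus reduces
to twists and quotients. -/
lemma IsTensorProduct.exists_epi [RightRigidCategory K] {M N L : Kᵒᵖ ⥤ AddCommGrpCat.{v}}
    (h : IsTensorProduct M N L) : ∃ (w : K) (p : TTGeometry.twist w N ⟶ L), Epi p := by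
  obtain ⟨x₁, x₀, y₁, y₀, f, g, -, hN, hL⟩ := h
  exact ⟨x₀ᘁ, (hN.twist x₀ x₀ᘁ).exists_epi hL biprod.inr (by simp)⟩

namespace IsSerreTensorIdeal

variable {B : ObjectProperty (Kᵒᵖ ⥤ AddCommGrpCat.{v})}

lemma eq_iff_unit (hB : IsSerreTensorIdeal B) :
    B = IsFinitelyPresented ↔ B (preadditiveYoneda.obj (𝟙_ K)) := by
  constructor
  · rintro rfl
    exact isFinitelyPresented_yoneda _
  · intro h
    exact le_antisymm hB.le_finitelyPresented
      fun M hM => hB.tensor_mem _ _ _ (isTensorProduct_unit hM) h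

lemma yoneda_tensor (hB : IsSerreTensorIdeal B) (x : K) {y : K}
    (h : B (preadditiveYoneda.obj y)) : B (preadditiveYoneda.obj (x ⊗ y)) :=
  hB.tensor_mem _ _ _ (isTensorProduct_yoneda x y) h

/-- The ideal of all modules `M` with `h(x) ⊗ M ∈ B`, where `w` is the dual of `x`. -/
lemma residual [BraidedCategory K] (hB : IsSerreTensorIdeal B) (x w : K) [ExactPairing x w] :
    IsSerreTensorIdeal (fun M => IsFinitelyPresented M ∧ B (twist w M)) where
  le_finitelyPresented := fun _ h => h.1
  zero_mem M hM := ⟨hB.le_finitelyPresented _ (hB.zero_mem _ hM),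
    hB.zero_mem _ (((Functor.whiskeringLeft _ _ _).obj (tensorLeft w).op).map_isZero hM)⟩
  serre S hS h₁ h₂ h₃ := by
    have := hB.serre _ (twist_shortExact w hS) (h₁.twist x w) (h₂.twist x w) (h₃.twist x w)
    simp only [h₁, h₂, h₃, true_and]
    exact this
  tensor_mem M N L h hN := ⟨h.isFinitelyPresented, hB.tensor_mem _ _ _ (h.twist x w) hN.2⟩

end IsSerreTensorIdeal

end Tensor

/-! ### The Balmer spectrum is spectral -/

section Spectral

open scoped ZeroObject

variable {K : Type u} [Category.{v} K] [HasZeroObject K] [HasShift K ℤ] [Preadditive K]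
  [∀ n : ℤ, (shiftFunctor K n).Additive] [Pretriangulated K] [MonoidalCategory K]

namespace BalmerSpectrum

instance (P : BalmerSpectrum K) : P.obj.IsTriangulated := P.isTriangulated

instance (P : BalmerSpectrum K) : P.obj.IsStableUnderRetracts := P.isStableUnderRetracts

/-- The basic open set of all primes containing `x`. -/
def basicOpen (x : K) : Set (BalmerSpectrum K) := {P | P.obj x}

lemma supp_compl (x : K) : (supp x)ᶜ = basicOpen x := by
  ext P
  simp [supp, basicOpen]

lemma isOpen_basicOpen (x : K) : IsOpen (basicOpen x) :=
  TopologicalSpace.isOpen_generateFrom_of_mem ⟨x, (supp_compl x).symm⟩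

lemma basicOpen_zero : basicOpen (0 : K) = Set.univ :=
  Set.eq_univ_of_forall fun P => P.obj.prop_zero

lemma basicOpen_inter (x y : K) : basicOpen x ∩ basicOpen y = basicOpen (x ⊞ y) := by
  ext P
  exact ⟨fun h => P.obj.ext_of_isTriangulatedClosed₂ _ (binaryBiproductTriangle_distinguished x y)
      h.1 h.2,
    fun h => ⟨ObjectProperty.IsStableUnderRetracts.of_biprod_left P.obj h,
      ObjectProperty.IsStableUnderRetracts.of_biprod_right P.obj h⟩⟩

lemma isTopologicalBasis_basicOpen :
    TopologicalSpace.IsTopologicalBasis (Set.range (basicOpen (K := K))) where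
  exists_subset_inter := by
    rintro _ ⟨x, rfl⟩ _ ⟨y, rfl⟩ P hP
    exact ⟨_, ⟨x ⊞ y, rfl⟩, basicOpen_inter x y ▸ hP, (basicOpen_inter x y).ge⟩
  sUnion_eq := Set.eq_univ_of_forall fun P => ⟨_, ⟨0, rfl⟩, P.obj.prop_zero⟩
  eq_generateFrom := by
    change TopologicalSpace.generateFrom {U | ∃ x : K, U = (supp x)ᶜ} = _
    congr 1
    ext U
    exact exists_congr fun x => by rw [supp_compl, eq_comm]

instance : T0Space (BalmerSpectrum K) where
  t0 P Q h := by
    ext x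
    exact h.mem_open_iff (isOpen_basicOpen x)

/-- The prime of all `x` such that `basicOpen x` is large in a sense which is compatible with
finite intersections and finite unions. -/
def ofLarge (Φ : Set (BalmerSpectrum K) → Prop) (mono : ∀ U V, U ⊆ V → Φ U → Φ V)
    (univ : Φ Set.univ) (empty : ¬ Φ ∅)
    (inter : ∀ x y : K, Φ (basicOpen x) → Φ (basicOpen y) → Φ (basicOpen x ∩ basicOpen y))
    (union : ∀ U V, Φ (U ∪ V) → Φ U ∨ Φ V) : BalmerSpectrum K :=
  have hr : ObjectProperty.IsStableUnderRetracts fun x : K => Φ (basicOpen x) :=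
    ⟨fun r h => mono _ _ (fun P hP => P.obj.prop_of_retract r hP) h⟩
  { obj := fun x => Φ (basicOpen x)
    isStableUnderRetracts := hr
    isTriangulated :=
      { exists_zero := ⟨0, isZero_zero K, by rwa [basicOpen_zero]⟩
        isStableUnderShiftBy := fun n =>
          ⟨fun x h => mono _ _ (fun P hP => P.obj.le_shift n _ hP) h⟩
        ext₂' := fun T hT h₁ h₃ => ObjectProperty.le_isoClosure _ _ (mono _ _
          (fun P hP => P.obj.ext_of_isTriangulatedClosed₂ T hT hP.1 hP.2) (inter _ _ h₁ h₃)) }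
    tensor_mem := fun x y h => mono _ _ (fun P hP => P.tensor_mem x y hP) h
    unit_notMem := fun h => empty (mono _ _ (fun P hP => P.unit_notMem hP) h)
    mem_or_mem := fun x y h => union _ _ (mono _ _ (fun P hP => P.mem_or_mem x y hP) h) }

/-- An ultrafilter `F` containing `basicOpen x` converges to the prime of all `y` with `basicOpen y
∈ F`. -/
lemma isCompact_basicOpen (x : K) : IsCompact (basicOpen x) := by
  refine isCompact_iff_ultrafilter_le_nhds.2 fun F hF => ?_
  refine ⟨ofLarge (fun U => U ∈ F) (fun U V h hU => Filter.mem_of_superset hU h) Filter.univ_mem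
    F.empty_notMem (fun _ _ => Filter.inter_mem) fun U V => Ultrafilter.union_mem_iff.1,
    Filter.le_principal_iff.1 hF, ?_⟩
  rw [TopologicalSpace.nhds_generateFrom]
  refine le_iInf₂ fun U hU => Filter.le_principal_iff.2 ?_
  obtain ⟨hU, y, rfl⟩ := hU
  rw [supp_compl] at hU ⊢
  exact hU

lemma mem_closure_singleton_iff (P Q : BalmerSpectrum K) :
    P ∈ closure {Q} ↔ ∀ x, P.obj x → Q.obj x := by
  rw [isTopologicalBasis_basicOpen.mem_closure_iff]
  simp [basicOpen]

instance : SpectralSpace (BalmerSpectrum K) where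
  isCompact_univ := basicOpen_zero (K := K) ▸ isCompact_basicOpen (0 : K)
  sober {S} hS hS' := by
    -- The generic point of `S` is the union of the primes in `S`; irreducibility gives
    -- compatibility with intersections.
    refine ⟨ofLarge (fun U => (S ∩ U).Nonempty)
      (fun U V h hU => hU.mono (Set.inter_subset_inter_right S h)) (by simpa using hS.1) (by simp)
      (fun x y => hS.2 _ _ (isOpen_basicOpen x) (isOpen_basicOpen y)) fun U V h => ?_, ?_⟩
    · rwa [Set.inter_union_distrib_left, Set.union_nonempty] at h
    · refine Set.Subset.antisymm ?_ fun P hP => ?_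
      · rw [hS'.closure_subset_iff, Set.singleton_subset_iff]
        refine hS'.closure_subset (isTopologicalBasis_basicOpen.mem_closure_iff.2 ?_)
        rintro _ ⟨x, rfl⟩ h
        rw [Set.inter_comm]
        exact h
      · rw [mem_closure_singleton_iff]
        exact fun x hx => ⟨P, hP, hx⟩
  toQuasiSeparatedSpace := .of_isTopologicalBasis isTopologicalBasis_basicOpen fun x y => by
    rw [basicOpen_inter]
    exact isCompact_basicOpen _
  toPrespectralSpace := .of_isTopologicalBasis' isTopologicalBasis_basicOpen isCompact_basicOpen

end BalmerSpectrum

end Spectral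

/-! ### Compatibilities of twists -/

section Twist

variable {K : Type u} [Category.{v} K] [MonoidalCategory K]

/-- Twisting by a tensor product is an iterated twist. -/
def twistTensorIso (a b : K) (M : Kᵒᵖ ⥤ AddCommGrpCat.{v}) :
    twist a (twist b M) ≅ twist (b ⊗ a) M :=
  Functor.isoWhiskerRight (NatIso.op (tensorLeftTensor b a)) M

/-- Twists commute. -/
def twistComm [BraidedCategory K] (a b : K) (M : Kᵒᵖ ⥤ AddCommGrpCat.{v}) :
    twist a (twist b M) ≅ twist b (twist a M) :=
  Functor.isoWhiskerRight (NatIso.op (NatIso.ofComponents (tensorLeftComm a b)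
    (fun f => tensorLeftComm_naturality_right a b f) :
      tensorLeft b ⋙ tensorLeft a ≅ tensorLeft a ⋙ tensorLeft b)) M

variable [Preadditive K] [MonoidalPreadditive K]

lemma isTensorProduct_twist [HasBinaryBiproducts K] (x w : K) [ExactPairing x w]
    {M : Kᵒᵖ ⥤ AddCommGrpCat.{v}} (h : IsFinitelyPresented M) :
    IsTensorProduct (preadditiveYoneda.obj x) M (twist w M) := by
  obtain ⟨y₁, y₀, g, hg⟩ := h
  refine ⟨x, x, y₁, y₀, 0, g, isPresentedBy_zero _ _, hg, ?_⟩
  refine (hg.twist x w).change (Iso.refl _) biprod.inr ?_ (biprod.desc 0 (𝟙 _)) ?_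
  · simp
  · ext <;> simp

lemma nonempty_twist_yoneda_iso (x w y : K) [ExactPairing x w] :
    Nonempty (twist w (preadditiveYoneda.obj y) ≅ preadditiveYoneda.obj (x ⊗ y)) := by
  obtain ⟨e⟩ := (isPresentedBy_zero y y).twist x w
  rw [MonoidalPreadditive.whiskerLeft_zero] at e
  obtain ⟨e'⟩ := isPresentedBy_zero (x ⊗ y) (x ⊗ y)
  exact ⟨e ≪≫ e'.symm⟩

end Twist

/-! ### Homological primes: existence and primality -/

section Zorn

variable {K : Type u} [Category.{v} K] [Preadditive K] [MonoidalCategory K]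
  [HasBinaryBiproducts K]

lemma IsSerreTensorIdeal.of_isChain {c : Set (ObjectProperty (Kᵒᵖ ⥤ AddCommGrpCat.{v}))}
    (hc : ∀ B ∈ c, IsSerreTensorIdeal B) (hc' : IsChain (· ≤ ·) c) (hne : c.Nonempty) :
    IsSerreTensorIdeal fun M => ∃ B ∈ c, B M where
  le_finitelyPresented := fun _ ⟨B, hB, h⟩ => (hc B hB).le_finitelyPresented _ h
  zero_mem M hM :=
    let ⟨B, hB⟩ := hne
    ⟨B, hB, (hc B hB).zero_mem M hM⟩
  serre S hS h₁ h₂ h₃ := by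
    constructor
    · rintro ⟨B, hB, h⟩
      have := ((hc B hB).serre S hS h₁ h₂ h₃).1 h
      exact ⟨⟨B, hB, this.1⟩, ⟨B, hB, this.2⟩⟩
    · rintro ⟨⟨B, hB, h⟩, ⟨B', hB', h'⟩⟩
      obtain hle | hle := hc'.total hB hB'
      · exact ⟨B', hB', ((hc B' hB').serre S hS h₁ h₂ h₃).2 ⟨hle _ h, h'⟩⟩
      · exact ⟨B, hB, ((hc B hB).serre S hS h₁ h₂ h₃).2 ⟨h, hle _ h'⟩⟩
  tensor_mem M N L hL := fun ⟨B, hB, h⟩ => ⟨B, hB, (hc B hB).tensor_mem M N L hL h⟩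

/-- Properness means `h(𝟙)` is absent, a condition that survives unions of chains. -/
lemma IsSerreTensorIdeal.exists_le_homologicalPrime [MonoidalPreadditive K]
    {B₀ : ObjectProperty (Kᵒᵖ ⥤ AddCommGrpCat.{v})} (h : IsSerreTensorIdeal B₀)
    (h' : ¬ B₀ (preadditiveYoneda.obj (𝟙_ K))) :
    ∃ B : HomologicalSpectrum K, B₀ ≤ B.obj := by
  obtain ⟨B, hle, hB⟩ := zorn_le_nonempty₀
    {B | IsSerreTensorIdeal B ∧ B ≠ (IsFinitelyPresented (K := K))} (fun c hc hc' y hy => by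
      have hI := IsSerreTensorIdeal.of_isChain (fun B hB => (hc hB).1) hc' ⟨y, hy⟩
      refine ⟨_, ⟨hI, fun heq => ?_⟩, fun B hB M hM => ⟨B, hB, hM⟩⟩
      obtain ⟨B, hB, h⟩ := hI.eq_iff_unit.1 heq
      exact (hc hB).2 ((hc hB).1.eq_iff_unit.2 h)) B₀ ⟨h, fun heq => h' (h.eq_iff_unit.1 heq)⟩
  exact ⟨⟨B, hB⟩, hle⟩

end Zorn

namespace HomologicalSpectrum

section

variable {K : Type u} [Category.{v} K] [Preadditive K] [MonoidalCategory K]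
  [HasBinaryBiproducts K]

lemma isSerreTensorIdeal (B : HomologicalSpectrum K) : IsSerreTensorIdeal B.obj :=
  B.isMaximal.prop.1

variable [MonoidalPreadditive K]

lemma unit_notMem (B : HomologicalSpectrum K) : ¬ B.obj (preadditiveYoneda.obj (𝟙_ K)) :=
  fun h => B.isMaximal.prop.2 (B.isSerreTensorIdeal.eq_iff_unit.2 h)

/-- When `h(x) ∉ B`, maximality forces the residual ideal of `x` to equal `B`, and `h(y)` lies in
that residual ideal. -/
lemma yoneda_mem_or_mem [BraidedCategory K] [RightRigidCategory K] (B : HomologicalSpectrum K)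
    (x y : K) (h : B.obj (preadditiveYoneda.obj (x ⊗ y))) :
    B.obj (preadditiveYoneda.obj x) ∨ B.obj (preadditiveYoneda.obj y) := by
  refine or_iff_not_imp_left.2 fun hx => ?_
  have hB := B.isSerreTensorIdeal
  have hE := hB.residual x xᘁ
  refine B.isMaximal.le_of_ge ⟨hE, fun heq => hx ?_⟩
    (fun M hM => ⟨hB.le_finitelyPresented _ hM, hB.tensor_mem _ _ _
      (isTensorProduct_twist x xᘁ (hB.le_finitelyPresented _ hM)) hM⟩) _
    ⟨isFinitelyPresented_yoneda y, ?_⟩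
  · obtain ⟨e⟩ := nonempty_twist_yoneda_iso x xᘁ (𝟙_ K)
    exact hB.of_iso (e ≪≫ preadditiveYoneda.mapIso (ρ_ x)) (hE.eq_iff_unit.1 heq).2
  · obtain ⟨e⟩ := nonempty_twist_yoneda_iso x xᘁ y
    exact hB.of_iso e.symm h

end

end HomologicalSpectrum

/-! ### The comparison map is well defined -/

section Comap

variable {K : Type u} [Category.{v} K] [HasZeroObject K] [HasShift K ℤ] [Preadditive K]
  [∀ n : ℤ, (shiftFunctor K n).Additive] [Pretriangulated K] [MonoidalCategory K]

namespace IsSerreTensorIdeal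

variable {B : ObjectProperty (Kᵒᵖ ⥤ AddCommGrpCat.{v})}

/-- Adjacent vertices of a triangle share one of these kernels, so membership in `B` can be passed
along by rotation. -/
lemma yoneda_obj₂_iff (hB : IsSerreTensorIdeal B) {T : Triangle K} (hT : T ∈ distTriang K) :
    B (preadditiveYoneda.obj T.obj₂) ↔ B (kernel (preadditiveYoneda.map T.mor₂)) ∧
      B (kernel (preadditiveYoneda.map T.mor₃)) :=
  hB.serre _ (shortExact_kernel hT) (isFinitelyPresented_kernel hT)
    (isFinitelyPresented_yoneda _) (isFinitelyPresented_kernel (rot_of_distTriang _ hT))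

lemma yoneda_retract (hB : IsSerreTensorIdeal B) {x y : K} (r : Retract x y)
    (h : B (preadditiveYoneda.obj y)) : B (preadditiveYoneda.obj x) := by
  -- Of the two kernels governing `h(x)`, that of the split mono `r.i` vanishes and the next one is
  -- a submodule of `h(y)`.
  obtain ⟨z, f, g, hT⟩ := distinguished_cocone_triangle₁ r.i
  have : Mono (preadditiveYoneda.map (Triangle.mk f r.i g).mor₂) :=
    inferInstanceAs (Mono (preadditiveYoneda.map r.i))
  exact (hB.yoneda_obj₂_iff hT).2 ⟨hB.zero_mem _ (isZero_kernel_of_mono _),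
    ((hB.yoneda_obj₂_iff (rot_of_distTriang _ hT)).1 h).1⟩

lemma isStableUnderRetracts_inverseImage (hB : IsSerreTensorIdeal B) :
    (B.inverseImage preadditiveYoneda).IsStableUnderRetracts :=
  ⟨fun r h => hB.yoneda_retract r h⟩

variable [MonoidalPreadditive K] [BraidedCategory K] [∀ x : K, (tensorLeft x).CommShift ℤ]

lemma yoneda_shift (hB : IsSerreTensorIdeal B) {x : K} (h : B (preadditiveYoneda.obj x)) (n : ℤ) :
    B (preadditiveYoneda.obj (x⟦n⟧)) := by
  let e : (𝟙_ K)⟦n⟧ ⊗ x ≅ x⟦n⟧ := β_ _ _ ≪≫ ((tensorLeft x).commShiftIso n).app (𝟙_ K) ≪≫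
    (shiftFunctor K n).mapIso (ρ_ x)
  exact hB.of_iso (preadditiveYoneda.mapIso e) (hB.yoneda_tensor _ h)

lemma isTriangulated_inverseImage (hB : IsSerreTensorIdeal B) :
    (B.inverseImage preadditiveYoneda).IsTriangulated := by
  have := hB.isStableUnderRetracts_inverseImage
  have : (B.inverseImage preadditiveYoneda).IsStableUnderShift ℤ :=
    ⟨fun n => ⟨fun x h => hB.yoneda_shift h n⟩⟩
  have : (B.inverseImage preadditiveYoneda).IsTriangulatedClosed₃ := .mk' fun T hT h₁ h₂ =>
    (hB.yoneda_obj₂_iff (rot_of_distTriang _ hT)).2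
      ⟨((hB.yoneda_obj₂_iff hT).1 h₂).2,
        ((hB.yoneda_obj₂_iff (rot_of_distTriang _ (rot_of_distTriang _ hT))).1
          (hB.yoneda_shift h₁ 1)).1⟩
  have := ObjectProperty.IsTriangulatedClosed₂.of_isTriangulatedClosed₃
    (P := B.inverseImage preadditiveYoneda)
  exact { exists_zero := ⟨_, isZero_zero K,
    hB.zero_mem _ (preadditiveYoneda.map_isZero (isZero_zero K))⟩ }

end IsSerreTensorIdeal

/-- The comparison map from the homological spectrum to the Balmer spectrum. -/
def HomologicalSpectrum.comap [MonoidalPreadditive K] [BraidedCategory K]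
    [∀ x : K, (tensorLeft x).CommShift ℤ] [RightRigidCategory K]
    (B : HomologicalSpectrum K) : BalmerSpectrum K where
  obj := B.obj.inverseImage preadditiveYoneda
  isTriangulated := B.isSerreTensorIdeal.isTriangulated_inverseImage
  isStableUnderRetracts := B.isSerreTensorIdeal.isStableUnderRetracts_inverseImage
  tensor_mem x _ h := B.isSerreTensorIdeal.yoneda_tensor x h
  unit_notMem := B.unit_notMem
  mem_or_mem := B.yoneda_mem_or_mem

end Comap

/-! ### Modules vanishing in the localization at a prime -/

section Localization

open scoped ZeroObject

variable {K : Type u} [Category.{v} K] [HasZeroObject K] [HasShift K ℤ] [Preadditive K]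
  [∀ n : ℤ, (shiftFunctor K n).Additive] [Pretriangulated K]

/-- The presheaves that vanish after localization at the triangulated subcategory `P`: every
section is killed by a morphism whose cone belongs to `P`. -/
def locallyZero (P : ObjectProperty K) : ObjectProperty (Kᵒᵖ ⥤ AddCommGrpCat.{v}) :=
  fun M => ∀ (z : K) (m : M.obj (op z)), ∃ (z' : K) (s : z' ⟶ z), P.trW s ∧ M.map s.op m = 0

namespace locallyZero

variable {P : ObjectProperty K}

lemma of_injective {M N : Kᵒᵖ ⥤ AddCommGrpCat.{v}} (p : M ⟶ N)
    (hp : ∀ z, Function.Injective (p.app z)) (h : locallyZero P N) : locallyZero P M := by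
  intro z m
  obtain ⟨z', s, hs, h⟩ := h z (p.app _ m)
  refine ⟨z', s, hs, hp _ ?_⟩
  rw [map_zero, ← h]
  exact NatTrans.naturality_apply p s.op m

lemma of_surjective {M N : Kᵒᵖ ⥤ AddCommGrpCat.{v}} (p : M ⟶ N)
    (hp : ∀ z, Function.Surjective (p.app z)) (h : locallyZero P M) : locallyZero P N := by
  intro z n
  obtain ⟨m, rfl⟩ := hp _ n
  obtain ⟨z', s, hs, h⟩ := h z m
  refine ⟨z', s, hs, ?_⟩
  rw [← map_zero (p.app (op z')).hom, ← h]
  exact (NatTrans.naturality_apply p s.op m).symm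

lemma of_iso {M N : Kᵒᵖ ⥤ AddCommGrpCat.{v}} (e : M ≅ N) (h : locallyZero P M) :
    locallyZero P N :=
  h.of_surjective e.hom ((epi_iff_forall_surjective _).1 inferInstance)

/-- Kill the image in `N` first, lift the restricted section to `L`, and kill it there; the two
denominators compose. -/
lemma of_exact [IsTriangulated K] [P.IsTriangulated] {L M N : Kᵒᵖ ⥤ AddCommGrpCat.{v}}
    (i : L ⟶ M) (p : M ⟶ N) (hip : ∀ z, Function.Exact (i.app z) (p.app z))
    (hL : locallyZero P L) (hN : locallyZero P N) : locallyZero P M := by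
  intro z m
  obtain ⟨z', s, hs, h⟩ := hN z (p.app _ m)
  obtain ⟨l, hl⟩ := (hip _ (M.map s.op m)).1 ((NatTrans.naturality_apply p s.op m).trans h)
  obtain ⟨z'', t, ht, h'⟩ := hL z' l
  refine ⟨z'', t ≫ s, P.trW.comp_mem _ _ ht hs, ?_⟩
  rw [op_comp, M.map_comp, ConcreteCategory.comp_apply, ← hl, ← NatTrans.naturality_apply, h',
    map_zero]

lemma yoneda {x : K} (hx : P x) : locallyZero P (preadditiveYoneda.obj x) := by
  intro z (m : z ⟶ x)
  obtain ⟨y, f, g, hT⟩ := distinguished_cocone_triangle₁ m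
  exact ⟨y, f, ⟨x, m, g, hT, hx⟩, comp_distTriang_mor_zero₁₂ _ hT⟩

/-- A denominator killing `𝟙 x` is zero, so `x` is a retract of its cone, which lies in `P`. -/
lemma mem_of_yoneda [P.IsTriangulated] [P.IsStableUnderRetracts] {x : K}
    (h : locallyZero P (preadditiveYoneda.obj x)) : P x := by
  obtain ⟨z, s, ⟨c, f, g, hT, hc⟩, hs⟩ := h x (𝟙 x)
  have hs' : s = 0 := (Category.comp_id s).symm.trans hs
  obtain ⟨r, hr⟩ := Triangle.yoneda_exact₂ _ hT (𝟙 x)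
    ((Category.comp_id (Y := x) s).trans hs')
  exact P.prop_of_retract ⟨f, r, hr.symm⟩ hc

end locallyZero

variable [MonoidalCategory K] (P : BalmerSpectrum K)

lemma BalmerSpectrum.not_tensor_mem {x y : K} (hx : ¬ P.obj x) (hy : ¬ P.obj y) :
    ¬ P.obj (x ⊗ y) :=
  fun h => (P.mem_or_mem x y h).elim hx hy

/-- The finitely presented modules `M` such that `h(w) ⊗ M` vanishes after localization at `P`,
for some object `w` not in `P`. -/
def BalmerSpectrum.torsion : ObjectProperty (Kᵒᵖ ⥤ AddCommGrpCat.{v}) :=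
  fun M => IsFinitelyPresented M ∧ ∃ w : K, ¬ P.obj w ∧ locallyZero P.obj (twist w M)

lemma BalmerSpectrum.unit_notMem_torsion [BraidedCategory K] [LeftRigidCategory K]
    [MonoidalPreadditive K] :
    ¬ P.torsion (preadditiveYoneda.obj (𝟙_ K)) := by
  rintro ⟨-, w, hw, h⟩
  obtain ⟨e⟩ := nonempty_twist_yoneda_iso (ᘁw) w (𝟙_ K)
  have h₁ : P.obj (ᘁw) := (h.of_iso (e ≪≫ preadditiveYoneda.mapIso (ρ_ _))).mem_of_yoneda
  have h₂ : P.obj ((w ⊗ ᘁw) ⊗ w) := P.obj.prop_of_iso (β_ _ _)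
    (P.tensor_mem w _ (P.tensor_mem w _ h₁))
  -- By a triangle identity, `w` is a retract of `(w ⊗ ᘁw) ⊗ w`.
  refine hw (P.obj.prop_of_retract ⟨(ρ_ w).inv ≫ w ◁ η_ (ᘁw) w ≫ (α_ _ _ _).inv,
    ε_ (ᘁw) w ▷ w ≫ (λ_ w).hom, ?_⟩ h₂)
  simp

variable [∀ x : K, (tensorLeft x).CommShift ℤ] [∀ x : K, (tensorLeft x).IsTriangulated]

lemma BalmerSpectrum.trW_whiskerLeft (x : K) {a b : K} {s : a ⟶ b} (hs : P.obj.trW s) :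
    P.obj.trW (x ◁ s) :=
  (P.obj.inverseImage_trW_iff (tensorLeft x) s).1
    (ObjectProperty.trW_monotone (fun y hy => P.tensor_mem x y hy) _ hs)

/-- If `x ∉ P`, then the kernel of the coevaluation of `x` is killed by `x`. -/
lemma BalmerSpectrum.kernel_coevaluation_mem_torsion [BraidedCategory K] [RightRigidCategory K]
    {x : K} (hx : ¬ P.obj x) :
    P.torsion (kernel (preadditiveYoneda.map (η_ x xᘁ))) := by
  obtain ⟨y, f, g, hT⟩ := distinguished_cocone_triangle₁ (η_ x xᘁ)
  -- The twisted kernel is zero even before localizing, so the identity serves as denominator.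
  refine ⟨isFinitelyPresented_kernel hT, x, hx, fun z n => ⟨z, 𝟙 z,
    MorphismProperty.id_mem _ _, ?_⟩⟩
  let _ := BraidedCategory.exactPairing_swap x xᘁ
  let adj := tensorLeftAdjunction xᘁ x
  let i := kernel.ι (preadditiveYoneda.map (η_ x xᘁ))
  let a : x ⊗ z ⟶ 𝟙_ K := i.app (op (x ⊗ z)) n
  have ha : a ≫ η_ x xᘁ = 0 :=
    (kernel_ι_exact (preadditiveYoneda.map (η_ x xᘁ)) _).apply_apply_eq_zero n
  let b : z ⟶ xᘁ ⊗ 𝟙_ K := adj.homEquiv _ _ a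
  have hb : b ≫ xᘁ ◁ η_ x xᘁ = 0 := by
    have := adj.homEquiv_naturality_right a (η_ x xᘁ)
    rw [ha, adj.homEquiv_unit, Functor.map_zero, comp_zero] at this
    exact this.symm
  -- By a triangle identity, `xᘁ ◁ η` is a split monomorphism.
  have hc : b = 0 := by
    have h' := b ≫= ExactPairing.coevaluation_evaluation x xᘁ
    rw [reassoc_of% hb, zero_comp, ← Category.assoc] at h'
    exact zero_of_comp_mono (ρ_ xᘁ).hom (zero_of_comp_mono (λ_ xᘁ).inv h'.symm)
  have hd : a = 0 := by
    apply (adj.homEquiv _ _).injective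
    exact hc.trans (by rw [adj.homEquiv_unit, Functor.map_zero, comp_zero])
  have he : n = 0 := kernel_ι_injective (preadditiveYoneda.map (η_ x xᘁ)) _
    (hd.trans (map_zero (i.app (op (x ⊗ z))).hom).symm)
  rw [he, map_zero]

variable [IsTriangulated K] [LeftRigidCategory K]

variable {P} in
-- The given denominator `s` lives over `w ⊗ z`, but one over `z` is needed. The Ore condition pulls
-- `ᘁw ◁ s` back along the unit `z ⟶ ᘁw ⊗ (w ⊗ z)`; by adjunction, `w ◁` the new denominator factors
-- through `s`.
lemma locallyZero.twist {M : Kᵒᵖ ⥤ AddCommGrpCat.{v}} (h : locallyZero P.obj M) (w : K) :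
    locallyZero P.obj (twist w M) := by
  intro z (m : M.obj (op (w ⊗ z)))
  obtain ⟨t, s, hs, h⟩ := h (w ⊗ z) m
  let adj := tensorLeftAdjunction (ᘁw) w
  let η : z ⟶ (ᘁw) ⊗ (w ⊗ z) := adj.homEquiv _ _ (𝟙 (w ⊗ z))
  let φ : P.obj.trW.LeftFraction z ((ᘁw) ⊗ t) :=
    { Y' := (ᘁw) ⊗ (w ⊗ z), f := η, s := (ᘁw) ◁ s, hs := P.trW_whiskerLeft (ᘁw) hs }
  obtain ⟨ψ, hψ⟩ := φ.exists_rightFraction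
  refine ⟨_, ψ.s, ψ.hs, ?_⟩
  have key : w ◁ ψ.s = (adj.homEquiv _ _).symm ψ.f ≫ s := by
    apply (adj.homEquiv _ _).injective
    have h₁ := adj.homEquiv_naturality_left ψ.s (𝟙 (w ⊗ z))
    have h₂ := adj.homEquiv_naturality_right ((adj.homEquiv _ _).symm ψ.f) s
    rw [Equiv.apply_symm_apply] at h₂
    exact ((congrArg _ (Category.comp_id (w ◁ ψ.s)).symm).trans h₁).trans (hψ.trans h₂.symm)
  change M.map (w ◁ ψ.s).op m = 0
  rw [key, op_comp, M.map_comp, ConcreteCategory.comp_apply, h, map_zero]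

lemma BalmerSpectrum.yoneda_mem_torsion {x : K} (hx : P.obj x) :
    P.torsion (preadditiveYoneda.obj x) :=
  ⟨isFinitelyPresented_yoneda x, 𝟙_ K, P.unit_notMem, (locallyZero.yoneda hx).twist _⟩

variable [MonoidalPreadditive K]

lemma BalmerSpectrum.isSerreTensorIdeal_torsion [BraidedCategory K] [RightRigidCategory K] :
    IsSerreTensorIdeal P.torsion where
  le_finitelyPresented := fun _ h => h.1
  zero_mem M hM :=
    let e : preadditiveYoneda.obj 0 ≅ M := (preadditiveYoneda.map_isZero (isZero_zero K)).iso hM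
    ⟨(isFinitelyPresented_yoneda _).of_iso e, 𝟙_ K, P.unit_notMem,
      ((locallyZero.yoneda P.obj.prop_zero).of_iso e).twist _⟩
  serre S hS h₁ h₂ h₃ := by
    obtain ⟨hf, hfg, hg⟩ := (shortExact_iff_forall_app S).1 hS
    constructor
    · rintro ⟨-, w, hw, h⟩
      exact ⟨⟨h₁, w, hw, h.of_injective (Functor.whiskerLeft _ S.f) fun z => hf _⟩,
        ⟨h₃, w, hw, h.of_surjective (Functor.whiskerLeft _ S.g) fun z => hg _⟩⟩
    · rintro ⟨⟨-, a, ha, hLa⟩, ⟨-, b, hb, hNb⟩⟩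
      -- Primality of `P` is what provides a common witness for both ends of the extension.
      refine ⟨h₂, a ⊗ b, P.not_tensor_mem ha hb, ?_⟩
      refine locallyZero.of_exact (L := twist (a ⊗ b) S.X₁) (N := twist (a ⊗ b) S.X₃)
        (Functor.whiskerLeft _ S.f) (Functor.whiskerLeft _ S.g)
        (fun z => hfg _) ?_ ?_
      · exact (hLa.twist b).of_iso (twistTensorIso b a _)
      · exact (hNb.twist a).of_iso (twistComm a b _ ≪≫ twistTensorIso b a _)
  tensor_mem M N L h := by
    rintro ⟨-, w, hw, hN⟩
    obtain ⟨x, p, hp⟩ := h.exists_epi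
    exact ⟨h.isFinitelyPresented, w, hw, ((hN.twist x).of_iso (twistComm x w N)).of_surjective
      (Functor.whiskerLeft _ p) fun z => (epi_iff_forall_surjective p).1 hp _⟩

end Localization

/-! ### The comparison map is surjective and inducing -/

section Comparison

variable {K : Type u} [Category.{v} K]
    [HasZeroObject K] [HasShift K ℤ] [Preadditive K]
    [∀ n : ℤ, (shiftFunctor K n).Additive] [Pretriangulated K]
    [MonoidalCategory K] [BraidedCategory K] [MonoidalPreadditive K]
    [∀ x : K, (tensorLeft x).CommShift ℤ]

namespace HomologicalSpectrum

lemma comap_surjective [IsTriangulated K] [∀ x : K, (tensorLeft x).IsTriangulated]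
    [RigidCategory K] : Function.Surjective (comap (K := K)) := by
  intro P
  obtain ⟨B, hB⟩ := P.isSerreTensorIdeal_torsion.exists_le_homologicalPrime P.unit_notMem_torsion
  refine ⟨B, ?_⟩
  ext x
  refine ⟨fun (h : B.obj (preadditiveYoneda.obj x)) => by_contra fun hx => B.unit_notMem ?_,
    fun h => hB _ (P.yoneda_mem_torsion h)⟩
  have hs := B.isSerreTensorIdeal
  obtain ⟨y, f, g, hT⟩ := distinguished_cocone_triangle₁ (η_ x xᘁ)
  have h' : B.obj (preadditiveYoneda.obj (x ⊗ xᘁ)) :=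
    hs.of_iso (preadditiveYoneda.mapIso (β_ _ _)) (hs.yoneda_tensor xᘁ h)
  -- The second kernel is the image of `h(𝟙)` in `h(x ⊗ xᘁ)`, which lies in `B`.
  exact (hs.yoneda_obj₂_iff hT).2 ⟨hB _ (P.kernel_coevaluation_mem_torsion hx),
    ((hs.yoneda_obj₂_iff (rot_of_distTriang _ hT)).1 h').1⟩

variable [RightRigidCategory K]

lemma isInducing_comap : Topology.IsInducing (comap (K := K)) where
  eq_induced := by
    refine Eq.trans ?_ induced_generateFrom_eq.symm
    change TopologicalSpace.generateFrom {U | ∃ x : K, U = (homologicalSupp x)ᶜ} = _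
    congr 1
    ext U
    constructor
    · rintro ⟨x, rfl⟩
      exact ⟨_, ⟨x, rfl⟩, rfl⟩
    · rintro ⟨_, ⟨x, rfl⟩, rfl⟩
      exact ⟨x, rfl⟩

end HomologicalSpectrum

end Comparison

/-! ### Inducing surjections onto T₀ and spectral spaces -/

section Kolmogorov

variable {X Y : Type*} [TopologicalSpace X] [TopologicalSpace Y] {f : X → Y}

lemma eq_iff_closure_eq_of_isInducing [T0Space Y] (hf : Topology.IsInducing f) (x y : X) :
    f x = f y ↔ closure {x} = closure {y} := by
  rw [← inseparable_iff_eq, hf.inseparable_iff, inseparable_iff_closure_eq]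

/-- An inducing map identifies only indistinguishable points when its target is T₀, and a surjective
one is open; so the map induced on the quotient is an open continuous bijection. -/
lemma isKolmogorovQuotient_of_isInducing [T0Space Y] (hf : Topology.IsInducing f)
    (hs : Function.Surjective f) : IsKolmogorovQuotient f := by
  have hl : ∀ x y : X, Inseparable x y → f x = f y := fun x y h => (h.map hf.continuous).eq
  have ho : IsOpenMap f := hf.isOpenMap (by rw [hs.range_eq]; exact isOpen_univ)
  have he : IsHomeomorph (SeparationQuotient.lift f hl) :=
    { continuous := hf.continuous.quotient_lift hl
      isOpenMap := .of_comp SeparationQuotient.continuous_mk SeparationQuotient.surjective_mk ho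
      bijective := by
        refine ⟨fun a b => ?_, fun y => ?_⟩
        · obtain ⟨x, rfl⟩ := SeparationQuotient.surjective_mk a
          obtain ⟨y, rfl⟩ := SeparationQuotient.surjective_mk b
          exact fun h => SeparationQuotient.mk_eq_mk.2 (hf.inseparable_iff.1 (.of_eq h))
        · obtain ⟨x, rfl⟩ := hs y
          exact ⟨SeparationQuotient.mk x, rfl⟩ }
  exact ⟨he.homeomorph, fun x => rfl⟩

lemma tfae_bijective_of_isInducing [SpectralSpace Y] (hf : Topology.IsInducing f)
    (hs : Function.Surjective f) :
    List.TFAE [Function.Bijective f, IsHomeomorph f, SpectralSpace X, T0Space X] := by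
  tfae_have 1 → 2 := fun h => isHomeomorph_iff_isEmbedding_surjective.2 ⟨⟨hf, h.1⟩, hs⟩
  tfae_have 2 → 3 := fun h => by
    have : CompactSpace X := h.homeomorph.symm.compactSpace
    exact h.isOpenEmbedding.spectralSpace
  tfae_have 3 → 4 := fun h => inferInstance
  tfae_have 4 → 1 := fun h => ⟨hf.injective, hs⟩
  tfae_finish

end Kolmogorov

end TTGeometry

theorem mainTheorem3 (K : Type u) [Category.{v} K] [EssentiallySmall.{w} K]
    [HasZeroObject K] [HasShift K ℤ] [Preadditive K]
    [∀ n : ℤ, (shiftFunctor K n).Additive] [Pretriangulated K] [IsTriangulated K]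
    [MonoidalCategory K] [SymmetricCategory K] [MonoidalPreadditive K]
    [∀ x : K, (tensorLeft x).CommShift ℤ] [∀ x : K, (tensorLeft x).IsTriangulated]
    [RigidCategory K] :
    ∃ φ : TTGeometry.HomologicalSpectrum K → TTGeometry.BalmerSpectrum K,
      (∀ B : TTGeometry.HomologicalSpectrum K,
        (φ B).obj = B.obj.inverseImage preadditiveYoneda) ∧
      TTGeometry.IsKolmogorovQuotient φ ∧
      (∀ B₁ B₂ : TTGeometry.HomologicalSpectrum K,
        φ B₁ = φ B₂ ↔ closure {B₁} = closure {B₂}) ∧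
      List.TFAE
        [Function.Bijective φ,
         IsHomeomorph φ,
         SpectralSpace (TTGeometry.HomologicalSpectrum K),
         T0Space (TTGeometry.HomologicalSpectrum K)] := by
  exact ⟨TTGeometry.HomologicalSpectrum.comap, fun _ => rfl,
    TTGeometry.isKolmogorovQuotient_of_isInducing
      TTGeometry.HomologicalSpectrum.isInducing_comap
      TTGeometry.HomologicalSpectrum.comap_surjective,
    TTGeometry.eq_iff_closure_eq_of_isInducing TTGeometry.HomologicalSpectrum.isInducing_comap,
    TTGeometry.tfae_bijective_of_isInducing TTGeometry.HomologicalSpectrum.isInducing_comap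
      TTGeometry.HomologicalSpectrum.comap_surjective⟩
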